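/- Let $Z=(Z_t)_{t\ge 0}$ be a real Lévy process on a probability space $(\Omega,\mathbb P)$, i.e. $Z_0=0$ a.s., $Z$ has independent and stationary increments, and almost all its paths are càdlàg. Suppose that $Z$ has no Gaussian part and has Lévy measure (jumping measure) $\nu$: $\nu$ is a measure on $\mathbb R$ with $\nu(\{0\})=0$ and $\int_{\mathbb R}\min(1,x^2)\,\nu(dx)<\infty$, and there is $\gamma\in\mathbb R$ such that for all $u\in\mathbb R$ $$\mathbb E\big[e^{iuZ_1}\big]=\exp\Big(i\gamma u+\int_{\mathbb R}\big(e^{iux}-1-iux\,\mathbf 1_{\{|x|\le 1\}}\big)\,\nu(dx)\Big).$$ Then $\int_0^1 Z_t\,dt$ is almost surely well defined as a Lebesgue integral and is a random variable (measurable up to a $\mathbb P$-null set), and its law is absolutely continuous with respect to Lebesgue measure on $\mathbb R$ if and only if $\nu$ is infinite, i.e. $\nu(\mathbb R)=\infty$. -/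

import Mathlib

open MeasureTheory ProbabilityTheory Filter Topology
open scoped NNReal ENNReal

/-- A function on `[0, ∞)` is càdlàg: right-continuous with finite left limits. -/
def IsCadlag (f : ℝ≥0 → ℝ) : Prop :=
  (∀ t, ContinuousWithinAt f (Set.Ici t) t) ∧
    ∀ t, 0 < t → ∃ l : ℝ, Tendsto f (𝓝[<] t) (𝓝 l)

/-- A real Lévy process `Z = (Z_t)_{t ≥ 0}` on the probability space `(Ω, P)`: it starts at `0`
almost surely, has independent and stationary increments, and almost all its paths are càdlàg. -/
structure IsLevyProcess {Ω : Type*} [MeasurableSpace Ω] (Z : ℝ≥0 → Ω → ℝ) (P : Measure Ω) :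
    Prop where
  measurable : ∀ t, Measurable (Z t)
  zero : ∀ᵐ ω ∂P, Z 0 ω = 0
  indep : HasIndepIncrements Z P
  stationary : ∀ s t, IdentDistrib (fun ω => Z (s + t) ω - Z s ω) (fun ω => Z t ω - Z 0 ω) P P
  cadlag : ∀ᵐ ω ∂P, IsCadlag (fun t => Z t ω)

/-- `ν` is a Lévy measure on `ℝ`: it does not charge `0` and integrates `min (1, x ^ 2)`. -/
structure IsLevyMeasure (ν : Measure ℝ) : Prop where
  singleton_zero : ν {0} = 0
  lintegral_lt_top : ∫⁻ x, ENNReal.ofReal (min 1 (x ^ 2)) ∂ν < ∞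

/-- The exponent
`i γ u - σ² u² / 2 + ∫ (exp (i u x) - 1 - i u x 1_{|x| ≤ 1}) ν(dx)`
attached to the drift `γ`, the Gaussian variance `σ²` and the measure `ν`. -/
noncomputable def levyExponent (γ : ℝ) (σsq : ℝ≥0) (ν : Measure ℝ) (u : ℝ) : ℂ :=
  Complex.I * γ * u - (σsq : ℝ) * (u : ℂ) ^ 2 / 2 +
    ∫ x : ℝ, (Complex.exp (Complex.I * u * x) - 1 -
      (Set.Icc (-1 : ℝ) 1).indicator (fun y : ℝ => Complex.I * u * y) x) ∂ν

/-- The process `Z` has generating triplet `(γ, σ², ν)`: `ν` is a Lévy measure and the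
characteristic function of `Z_1` is the exponential of the corresponding exponent. The number `σ²`
is the Gaussian part of `Z`, and `ν` is its Lévy (or jumping) measure. -/
structure HasLevyTriplet {Ω : Type*} [MeasurableSpace Ω] (Z : ℝ≥0 → Ω → ℝ) (P : Measure Ω)
    (γ : ℝ) (σsq : ℝ≥0) (ν : Measure ℝ) : Prop where
  isLevyMeasure : IsLevyMeasure ν
  charFun_eq : ∀ u : ℝ, charFun (P.map (Z 1)) u = Complex.exp (levyExponent γ σsq ν u)

/-! A jump of size `x` at time `t` contributes `(1 - t) * x` to the integral, so the integral should
have the Lévy measure `uniformScaling ν`, the image of `dt ⊗ ν` under multiplication. Rigorously,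
summation by parts writes a Riemann sum as a weighted sum of independent increments, and the limit
has characteristic function `exp (∫₀¹ ψ (s u) ds)`, with `ψ` the exponent of `Z 1`
(`charFun_integral`). The rest concerns only this characteristic function.

If `ν` is finite, the law is a translated compound Poisson law, and the event of no jump gives it an
atom.

If `ν` is infinite, keep only the jumps larger than `1 / (n + 1)`. For `x ≠ 0` the map `t ↦ t * x`
spreads a jump over an interval, so the scaled jump measure is finite and absolutely continuous; its
compound Poisson law charges null sets only through the atom at `0`, of mass `exp (-ν (largeJumps
n))`. Finer truncations are convolutions of this law with probability measures, so they satisfy the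
same bound on sets of small Lebesgue measure, uniformly, and the bound passes to the weak limit
(`measure_null_le_of_tendsto`). Letting `n → ∞` makes the atom vanish. -/

/-! ### Càdlàg paths, roots of characteristic functions, Riemann sums -/

/-- A càdlàg function is bounded on bounded intervals. -/
theorem IsCadlag.exists_norm_le {f : ℝ≥0 → ℝ} (hf : IsCadlag f) (T : ℝ≥0) :
    ∃ C, ∀ t ≤ T, ‖f t‖ ≤ C := by
  have key : Bornology.IsBounded (f '' Set.Icc 0 T) := by
    refine isCompact_Icc.induction_on (p := fun s => Bornology.IsBounded (f '' s)) (by simp)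
      (fun s t hst ht => ht.subset (Set.image_mono hst))
      (fun s t hs ht => by rw [Set.image_union]; exact hs.union ht) fun t _ => ?_
    have aux : ∀ {l : Filter ℝ≥0} {a : ℝ}, Tendsto f l (𝓝 a) →
        ∃ s ∈ l, Bornology.IsBounded (f '' s) := fun {l a} h =>
      ⟨f ⁻¹' Metric.ball a 1, h (Metric.ball_mem_nhds a one_pos),
        Metric.isBounded_ball.subset (Set.image_preimage_subset _ _)⟩
    obtain ⟨s, hs, hsb⟩ := aux (hf.1 t)
    obtain ⟨s', hs', hsb'⟩ : ∃ s ∈ 𝓝[<] t, Bornology.IsBounded (f '' s) := by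
      -- At `0` there are no points to the left, so the left limit is not needed.
      rcases eq_or_ne t 0 with rfl | ht
      · exact ⟨∅, by simp, by simp⟩
      · obtain ⟨l, hl⟩ := hf.2 t (pos_iff_ne_zero.2 ht)
        exact aux hl
    refine ⟨s' ∪ s, mem_nhdsWithin_of_mem_nhds ?_, ?_⟩
    · rw [← nhdsLT_sup_nhdsGE, mem_sup]
      exact ⟨mem_of_superset hs' Set.subset_union_left, mem_of_superset hs Set.subset_union_right⟩
    · rw [Set.image_union]; exact hsb'.union hsb
  obtain ⟨C, hC⟩ := key.exists_norm_le
  exact ⟨C, fun t ht => hC _ ⟨t, ⟨bot_le, ht⟩, rfl⟩⟩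

/-- Two continuous functions with equal `n`-th powers, where one is the exponential of a continuous
function, agree up to the choice of the root, which is fixed by the value at `0`. -/
theorem eq_exp_div_of_pow_eq_exp {φ ψ : ℝ → ℂ} (hφ : Continuous φ) (hψ : Continuous ψ)
    (hφ0 : φ 0 = 1) (hψ0 : ψ 0 = 0) {n : ℕ} (hn : n ≠ 0)
    (h : ∀ u, φ u ^ n = Complex.exp (ψ u)) (u : ℝ) : φ u = Complex.exp (ψ u / n) := by
  -- This quotient is continuous on the connected line and takes values in the finite set of `n`-th
  -- roots of unity, hence is constant.
  have hc : Continuous fun u => φ u * Complex.exp (-(ψ u / n)) := by fun_prop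
  have hpow : ∀ u, (φ u * Complex.exp (-(ψ u / n))) ^ n = 1 := fun u => by
    rw [mul_pow, h, ← Complex.exp_nat_mul, ← Complex.exp_add]
    have : (n : ℂ) ≠ 0 := by exact_mod_cast hn
    rw [mul_neg, mul_div_cancel₀ _ this, add_neg_cancel, Complex.exp_zero]
  have hfin : {z : ℂ | z ^ n = 1}.Finite := by
    refine (Polynomial.nthRootsFinset n (1 : ℂ)).finite_toSet.subset fun z hz => ?_
    simpa [Polynomial.mem_nthRootsFinset (Nat.pos_of_ne_zero hn)] using hz
  obtain ⟨c, -, hc'⟩ := isPreconnected_univ.eqOn_const_of_mapsTo hfin.isDiscrete hc.continuousOn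
    (fun u _ => hpow u) ⟨1, by simp⟩
  have h0 := hc' (Set.mem_univ 0)
  have hu := hc' (Set.mem_univ u)
  simp only [hφ0, hψ0, Function.const_apply, zero_div, neg_zero, Complex.exp_zero, mul_one] at h0 hu
  rw [← h0, Complex.exp_neg, mul_inv_eq_one₀ (Complex.exp_ne_zero _)] at hu
  exact hu

/-- Right Riemann sums of a bounded right-continuous function converge to its integral. -/
theorem tendsto_right_riemann_sum {E : Type*} [NormedAddCommGroup E] [NormedSpace ℝ E]
    [CompleteSpace E] {f : ℝ → E}
    {C : ℝ} (hC : ∀ t ∈ Set.Icc (0 : ℝ) 1, ‖f t‖ ≤ C)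
    (hf : ∀ t ∈ Set.Icc (0 : ℝ) 1, ContinuousWithinAt f (Set.Ici t) t) :
    IntervalIntegrable f volume 0 1 ∧
      Tendsto (fun n : ℕ => ((n + 1 : ℕ) : ℝ)⁻¹ •
        ∑ j ∈ Finset.range (n + 1), f (((j + 1 : ℕ) : ℝ) / ((n + 1 : ℕ) : ℝ))) atTop
        (𝓝 (∫ t in (0 : ℝ)..1, f t)) := by
  -- The step function samples `f` at the first grid point strictly to the right of `t`, so
  -- right-continuity suffices for pointwise convergence.
  set g : ℕ → ℝ → E := fun n t =>
    f (((⌊((n + 1 : ℕ) : ℝ) * t⌋₊ + 1 : ℕ) : ℝ) / ((n + 1 : ℕ) : ℝ)) with hg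
  have hgm : ∀ n, StronglyMeasurable (g n) := fun n => by
    have h1 : Measurable fun t : ℝ => ⌊((n + 1 : ℕ) : ℝ) * t⌋₊ :=
      Nat.measurable_floor.comp (measurable_id.const_mul _)
    exact (StronglyMeasurable.of_discrete
      (f := fun k : ℕ => f (((k + 1 : ℕ) : ℝ) / ((n + 1 : ℕ) : ℝ)))).comp_measurable h1
  -- The endpoint `t = 1` is excluded because its sample point would lie beyond `1`.
  have hbound : ∀ n, ∀ t ∈ Set.Ioo (0 : ℝ) 1, ‖g n t‖ ≤ C := fun n t ht => by
    refine hC _ ⟨by positivity, ?_⟩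
    have hn : (0 : ℝ) < ((n + 1 : ℕ) : ℝ) := by positivity
    rw [div_le_one hn, Nat.cast_le, Nat.succ_le_iff, Nat.floor_lt (by have := ht.1; positivity)]
    nlinarith [ht.2]
  have hlim : ∀ t ∈ Set.Ioo (0 : ℝ) 1, Tendsto (fun n => g n t) atTop (𝓝 (f t)) := fun t ht => by
    refine (hf t ⟨ht.1.le, ht.2.le⟩).tendsto.comp (tendsto_nhdsWithin_iff.2 ⟨?_, ?_⟩)
    · have h1 : Tendsto (fun n : ℕ => t + 1 / ((n : ℝ) + 1)) atTop (𝓝 t) := by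
        simpa using tendsto_const_nhds.add (tendsto_one_div_add_atTop_nhds_zero_nat (𝕜 := ℝ))
      refine tendsto_of_tendsto_of_tendsto_of_le_of_le tendsto_const_nhds h1 (fun n => ?_)
        fun n => ?_
      · have hn : (0 : ℝ) < ((n + 1 : ℕ) : ℝ) := by positivity
        simp only [le_div_iff₀ hn]
        have := (Nat.lt_floor_add_one (((n + 1 : ℕ) : ℝ) * t)).le
        push_cast at this ⊢; linarith
      · have hn : (0 : ℝ) < ((n + 1 : ℕ) : ℝ) := by positivity
        simp only [div_le_iff₀ hn]
        have := Nat.floor_le (a := ((n + 1 : ℕ) : ℝ) * t) (by have := ht.1; positivity)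
        push_cast at this ⊢
        have h3 : (t + 1 / ((n : ℝ) + 1)) * (n + 1) = t * (n + 1) + 1 := by
          field_simp
        rw [h3]; linarith
    · refine Eventually.of_forall fun n => ?_
      have hn : (0 : ℝ) < ((n + 1 : ℕ) : ℝ) := by positivity
      rw [Set.mem_Ici, le_div_iff₀ hn]
      have := (Nat.lt_floor_add_one (((n + 1 : ℕ) : ℝ) * t)).le
      push_cast at this ⊢; linarith
  have hae : ∀ {p : ℝ → Prop}, (∀ t ∈ Set.Ioo (0 : ℝ) 1, p t) →
      ∀ᵐ t ∂(volume.restrict (Set.Ioc (0 : ℝ) 1)), p t := fun {p} hp => by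
    rw [← restrict_Ioo_eq_restrict_Ioc]
    exact ae_restrict_of_forall_mem measurableSet_Ioo hp
  have hfm : AEStronglyMeasurable f (volume.restrict (Set.Ioc (0 : ℝ) 1)) :=
    aestronglyMeasurable_of_tendsto_ae atTop (fun n => (hgm n).aestronglyMeasurable) (hae hlim)
  have hint : IntervalIntegrable f volume 0 1 := by
    rw [intervalIntegrable_iff_integrableOn_Ioc_of_le zero_le_one]
    exact Integrable.of_bound hfm C (hae fun t ht => hC t ⟨ht.1.le, ht.2.le⟩)
  refine ⟨hint, ?_⟩
  have hT : Tendsto (fun n => ∫ t in (0 : ℝ)..1, g n t) atTop (𝓝 (∫ t in (0 : ℝ)..1, f t)) := by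
    simp only [intervalIntegral.integral_of_le zero_le_one]
    exact tendsto_integral_of_dominated_convergence (fun _ => C)
      (fun n => (hgm n).aestronglyMeasurable) (integrable_const C) (fun n => hae (hbound n))
      (hae hlim)
  refine hT.congr fun n => ?_
  have hn : (0 : ℝ) < ((n + 1 : ℕ) : ℝ) := by positivity
  set a : ℕ → ℝ := fun j => (j : ℝ) / ((n + 1 : ℕ) : ℝ) with ha
  have hpiece : ∀ j, Set.EqOn (g n) (fun _ => f (((j + 1 : ℕ) : ℝ) / ((n + 1 : ℕ) : ℝ)))
      (Set.Ioo (a j) (a (j + 1))) := fun j t ht => by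
    have h1 : ⌊((n + 1 : ℕ) : ℝ) * t⌋₊ = j := by
      have h0 : (j : ℝ) < t * ((n + 1 : ℕ) : ℝ) := (div_lt_iff₀ hn).1 ht.1
      have h2 : t * ((n + 1 : ℕ) : ℝ) < ((j + 1 : ℕ) : ℝ) := (lt_div_iff₀ hn).1 ht.2
      rw [Nat.floor_eq_iff (by nlinarith [Nat.cast_nonneg (α := ℝ) j])]
      push_cast at *
      constructor <;> linarith
    simp only [hg]; rw [h1]
  have hle : ∀ j, a j ≤ a (j + 1) := fun j => by
    simp only [ha]; gcongr; simp
  have hadj := intervalIntegral.sum_integral_adjacent_intervals (f := g n) (a := a) (n := n + 1)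
    (μ := volume) fun j _ => by
      rw [intervalIntegrable_iff_integrableOn_Ioo_of_le (hle j)]
      exact (integrableOn_congr_fun (hpiece j) measurableSet_Ioo).2 (by simp)
  have e0 : a 0 = 0 := by simp [ha]
  have e1 : a (n + 1) = 1 := by simp only [ha]; exact div_self hn.ne'
  rw [e0, e1] at hadj
  rw [← hadj, Finset.smul_sum]
  refine Finset.sum_congr rfl fun j _ => ?_
  rw [intervalIntegral.integral_of_le (hle j), integral_Ioc_eq_integral_Ioo,
    setIntegral_congr_fun measurableSet_Ioo (hpiece j), ← integral_Ioc_eq_integral_Ioo,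
    ← intervalIntegral.integral_of_le (hle j), intervalIntegral.integral_const]
  congr 1
  simp only [ha]; push_cast; field_simp; ring

/-! ### Compound Poisson laws and their mass on null sets -/

/-- The `n`-th convolution power of a measure on `ℝ`. -/
noncomputable def convPow (lam : Measure ℝ) : ℕ → Measure ℝ
  | 0 => Measure.dirac 0
  | n + 1 => convPow lam n ∗ lam

instance isFiniteMeasure_convPow (lam : Measure ℝ) [IsFiniteMeasure lam] (n : ℕ) :
    IsFiniteMeasure (convPow lam n) := by
  induction n with
  | zero => unfold convPow; infer_instance
  | succ n ih => unfold convPow; infer_instance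

theorem charFun_convPow (lam : Measure ℝ) [IsFiniteMeasure lam] (n : ℕ) (u : ℝ) :
    charFun (convPow lam n) u = charFun lam u ^ n := by
  induction n with
  | zero => simp [convPow]
  | succ n ih => rw [convPow, charFun_conv, ih, pow_succ]

theorem convPow_real_univ (lam : Measure ℝ) [IsFiniteMeasure lam] (n : ℕ) :
    (convPow lam n).real Set.univ = lam.real Set.univ ^ n := by
  have := charFun_convPow lam n 0
  simp only [charFun_zero] at this
  exact_mod_cast this

/-- The compound Poisson law with jump measure `lam`. -/
noncomputable def compoundPoisson (lam : Measure ℝ) : Measure ℝ :=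
  Measure.sum fun n : ℕ =>
    ENNReal.ofReal (Real.exp (-lam.real Set.univ) / n.factorial) • convPow lam n

instance isProbabilityMeasure_compoundPoisson (lam : Measure ℝ) [IsFiniteMeasure lam] :
    IsProbabilityMeasure (compoundPoisson lam) := by
  constructor
  rw [compoundPoisson, Measure.sum_apply _ MeasurableSet.univ]
  obtain ⟨r, hr⟩ : ∃ r : ℝ≥0, (r : ℝ) = lam.real Set.univ := ⟨⟨_, measureReal_nonneg⟩, rfl⟩
  have h := hasSum_one_poissonMeasure r
  rw [← ENNReal.ofReal_one, ← h.tsum_eq, ENNReal.ofReal_tsum_of_nonneg (fun n => by positivity)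
    h.summable]
  refine tsum_congr fun n => ?_
  rw [Measure.smul_apply, smul_eq_mul, ← ofReal_measureReal, convPow_real_univ, ← hr,
    ← ENNReal.ofReal_mul (by positivity)]
  congr 1
  ring

theorem charFun_compoundPoisson (lam : Measure ℝ) [IsFiniteMeasure lam] (u : ℝ) :
    charFun (compoundPoisson lam) u = Complex.exp (charFun lam u - lam.real Set.univ) := by
  have hi : Integrable (fun x : ℝ => Complex.exp (u * x * Complex.I)) (compoundPoisson lam) := by
    refine Integrable.of_bound (by fun_prop) 1 (ae_of_all _ fun x => ?_)
    rw [← Complex.ofReal_mul, Complex.norm_exp_ofReal_mul_I]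
  have h := hasSum_integral_measure hi
  rw [charFun_apply_real]
  refine (HasSum.unique h ?_)
  have h2 := (NormedSpace.expSeries_div_hasSum_exp (charFun lam u)).mul_left
    (Complex.exp (-(lam.real Set.univ : ℂ)))
  rw [← Complex.exp_eq_exp_ℂ, ← Complex.exp_add, neg_add_eq_sub] at h2
  refine h2.congr_fun fun n => ?_
  rw [integral_smul_measure, ← charFun_apply_real, charFun_convPow, ENNReal.toReal_ofReal
    (by positivity), Complex.real_smul]
  push_cast
  ring

/-- The logarithm of the characteristic function is additive in the jump measure. This is what
factors a coarse truncation out of a finer one. -/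
theorem compoundPoisson_add (l₁ l₂ : Measure ℝ) [IsFiniteMeasure l₁] [IsFiniteMeasure l₂] :
    compoundPoisson (l₁ + l₂) = compoundPoisson l₁ ∗ compoundPoisson l₂ := by
  refine Measure.ext_of_charFun (funext fun u => ?_)
  have hi : ∀ l : Measure ℝ, IsFiniteMeasure l →
      Integrable (fun x : ℝ => Complex.exp (u * x * Complex.I)) l := fun l _ => by
    refine Integrable.of_bound (by fun_prop) 1 (ae_of_all _ fun x => ?_)
    rw [← Complex.ofReal_mul, Complex.norm_exp_ofReal_mul_I]
  rw [charFun_conv, charFun_compoundPoisson, charFun_compoundPoisson, charFun_compoundPoisson,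
    ← Complex.exp_add, charFun_apply_real, integral_add_measure (hi l₁ ‹_›) (hi l₂ ‹_›),
    ← charFun_apply_real, ← charFun_apply_real, measureReal_add_apply]
  push_cast
  ring_nf

/-- A compound Poisson law is the sum of an atom at `0` and of a measure that is absolutely
continuous when the jump measure is. -/
theorem exists_compoundPoisson_eq_add (lam : Measure ℝ) [IsFiniteMeasure lam] :
    ∃ A : Measure ℝ, compoundPoisson lam =
      ENNReal.ofReal (Real.exp (-lam.real Set.univ)) • Measure.dirac 0 + A ∧
      (lam ≪ volume → A ≪ volume) := by
  refine ⟨Measure.sum fun n : ℕ => ENNReal.ofReal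
    (Real.exp (-lam.real Set.univ) / (n + 1).factorial) • convPow lam (n + 1), ?_, fun h => ?_⟩
  · ext s hs
    rw [compoundPoisson, Measure.sum_apply _ hs, Measure.add_apply, Measure.sum_apply _ hs,
      tsum_eq_zero_add' ENNReal.summable]
    simp [convPow]
  · refine Measure.absolutelyContinuous_sum_left fun n => ?_
    refine Measure.AbsolutelyContinuous.smul_left ?_ _
    exact Measure.conv_absolutelyContinuous h

/-- A uniform bound on the mass which a convolution with a compound Poisson law gives to sets of
small Lebesgue measure. -/
theorem exists_compoundPoisson_conv_le {lam : Measure ℝ} [IsFiniteMeasure lam]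
    (hlam : lam ≪ volume) {ε : ℝ≥0∞} (hε : ε ≠ 0) :
    ∃ δ > 0, ∀ (ρ : Measure ℝ) [IsProbabilityMeasure ρ] (U : Set ℝ), MeasurableSet U →
      volume U < δ →
      (compoundPoisson lam ∗ ρ) U ≤ ENNReal.ofReal (Real.exp (-lam.real Set.univ)) + ε := by
  obtain ⟨A, hA, hAc⟩ := exists_compoundPoisson_eq_add lam
  have hfin : IsFiniteMeasure A := by
    refine isFiniteMeasure_of_le (compoundPoisson lam) ?_
    rw [hA]; exact Measure.le_add_left le_rfl
  obtain ⟨δ, hδ, h⟩ : ∃ δ > 0, ∀ s, MeasurableSet s → volume s < δ → A s < ε := by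
    obtain ⟨δ, hδ, h⟩ := exists_pos_setLIntegral_lt_of_measure_lt (μ := volume)
      (Measure.lintegral_rnDeriv_lt_top A volume).ne hε
    refine ⟨δ, hδ, fun s hs hsδ => ?_⟩
    rw [← Measure.setLIntegral_rnDeriv (hAc hlam)]
    exact h s hsδ
  refine ⟨δ, hδ, fun ρ _ U hU hUδ => ?_⟩
  -- Translation invariance of Lebesgue measure makes `δ` independent of the shift `y`, hence of
  -- `ρ`.
  have hshift : ∀ y : ℝ, compoundPoisson lam ((fun x => y + x) ⁻¹' U) ≤
      ENNReal.ofReal (Real.exp (-lam.real Set.univ)) + ε := fun y => by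
    rw [hA, Measure.add_apply, Measure.smul_apply, smul_eq_mul]
    refine add_le_add (mul_le_of_le_one_right' prob_le_one) (h _ ?_ ?_).le
    · exact hU.preimage (by fun_prop)
    · rwa [measure_preimage_add]
  rw [Measure.conv_comm, ← lintegral_indicator_one hU, Measure.lintegral_conv
    (measurable_one.indicator hU)]
  calc ∫⁻ y, ∫⁻ x, U.indicator 1 (y + x) ∂(compoundPoisson lam) ∂ρ
      = ∫⁻ y, compoundPoisson lam ((fun x => y + x) ⁻¹' U) ∂ρ := by
        refine lintegral_congr fun y => ?_
        rw [← lintegral_indicator_one (hU.preimage (by fun_prop))]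
        rfl
    _ ≤ ∫⁻ _, ENNReal.ofReal (Real.exp (-lam.real Set.univ)) + ε ∂ρ := lintegral_mono hshift
    _ = _ := by simp

/-- If a weakly convergent sequence of probability measures eventually factors through a compound
Poisson law with absolutely continuous jump measure `lam`, then the limit gives at most mass
`exp (- lam univ)` to Lebesgue null sets. -/
theorem measure_null_le_of_tendsto {lam : Measure ℝ} [IsFiniteMeasure lam]
    (hlam : lam ≪ volume) {μs : ℕ → ProbabilityMeasure ℝ} {μ : ProbabilityMeasure ℝ}
    (hμ : Tendsto μs atTop (𝓝 μ))
    (hfac : ∀ᶠ m in atTop, ∃ R : Measure ℝ, IsProbabilityMeasure R ∧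
      (μs m : Measure ℝ) = compoundPoisson lam ∗ R) {N : Set ℝ} (hN : volume N = 0) :
    (μ : Measure ℝ) N ≤ ENNReal.ofReal (Real.exp (-lam.real Set.univ)) := by
  refine ENNReal.le_of_forall_pos_le_add fun ε hε _ => ?_
  obtain ⟨δ, hδ, h⟩ := exists_compoundPoisson_conv_le hlam (ε := ε) (by simpa using hε.ne')
  -- Weak convergence controls the limit from above only on open sets, so `N` is enlarged to an open
  -- set of small measure.
  obtain ⟨U, hNU, hU, hUδ⟩ := N.exists_isOpen_lt_of_lt δ (by rwa [hN])
  refine (measure_mono hNU).trans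
    ((ProbabilityMeasure.le_liminf_measure_open_of_tendsto hμ hU).trans ?_)
  refine liminf_le_of_frequently_le' (Eventually.frequently ?_)
  filter_upwards [hfac] with m ⟨R, hR, hm⟩
  rw [hm]
  exact h R U hU.measurableSet hUδ

/-! ### Bounds and continuity for the Lévy-Khintchine exponent -/

/-- The compensated integrand in the Lévy-Khintchine formula. -/
noncomputable def levyIntegrand (u x : ℝ) : ℂ :=
  Complex.exp (Complex.I * u * x) - 1 -
    (Set.Icc (-1 : ℝ) 1).indicator (fun y : ℝ => Complex.I * u * y) x

theorem levyExponent_zero_variance (γ : ℝ) (ν : Measure ℝ) (u : ℝ) :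
    levyExponent γ 0 ν u = Complex.I * γ * u + ∫ x, levyIntegrand u x ∂ν := by
  simp [levyExponent, levyIntegrand]

theorem measurable_levyIntegrand (u : ℝ) : Measurable (levyIntegrand u) := by
  unfold levyIntegrand
  refine Measurable.sub (by fun_prop) (Measurable.indicator (by fun_prop) measurableSet_Icc)

theorem continuous_levyIntegrand_left (x : ℝ) : Continuous fun u => levyIntegrand u x := by
  unfold levyIntegrand
  by_cases hx : x ∈ Set.Icc (-1 : ℝ) 1
  · simp only [Set.indicator_of_mem hx]; fun_prop
  · simp only [Set.indicator_of_notMem hx]; fun_prop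

theorem norm_levyIntegrand_le (u x : ℝ) :
    ‖levyIntegrand u x‖ ≤ (2 + 3 * u ^ 2) * min 1 (x ^ 2) := by
  have hexp : ‖Complex.exp (Complex.I * u * x) - 1‖ ≤ 2 := by
    refine (norm_sub_le _ _).trans ?_
    rw [mul_assoc, ← Complex.ofReal_mul, Complex.norm_exp_I_mul_ofReal]
    norm_num
  have hnorm : ‖Complex.I * u * x‖ = |u * x| := by
    rw [mul_assoc, ← Complex.ofReal_mul, norm_mul, Complex.norm_I, one_mul, Complex.norm_real,
      Real.norm_eq_abs]
  unfold levyIntegrand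
  by_cases hx : x ∈ Set.Icc (-1 : ℝ) 1
  · have hx2 : x ^ 2 ≤ 1 := by nlinarith [hx.1, hx.2]
    rw [Set.indicator_of_mem hx, min_eq_right hx2]
    -- For `|u * x| ≤ 1` the Taylor bound gives constant `1`; otherwise `2 + |u * x| ≤ 3 * |u * x| ^
    -- 2`.
    have key : ‖Complex.exp (Complex.I * u * x) - 1 - Complex.I * u * x‖ ≤ 3 * |u * x| ^ 2 := by
      rcases le_total |u * x| 1 with h | h
      · have := Complex.norm_exp_sub_one_sub_id_le (hnorm.trans_le h)
        rw [hnorm] at this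
        nlinarith [sq_nonneg |u * x|]
      · have := (norm_sub_le (Complex.exp (Complex.I * u * x) - 1) (Complex.I * u * x))
        rw [hnorm] at this
        nlinarith
    rw [sq_abs] at key
    nlinarith [sq_nonneg x]
  · rw [Set.indicator_of_notMem hx, sub_zero]
    have hx2 : 1 ≤ x ^ 2 := by
      by_contra! h
      exact hx (abs_le.1 (by nlinarith [sq_abs x, abs_nonneg x]))
    rw [min_eq_left hx2]
    nlinarith [sq_nonneg u]

namespace IsLevyMeasure

variable {ν : Measure ℝ}

theorem integrable_min (hν : IsLevyMeasure ν) : Integrable (fun x : ℝ => min 1 (x ^ 2)) ν := by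
  refine ⟨by fun_prop, ?_⟩
  rw [hasFiniteIntegral_iff_ofReal (ae_of_all _ fun x => by positivity)]
  exact hν.lintegral_lt_top

theorem restrict (hν : IsLevyMeasure ν) (s : Set ℝ) : IsLevyMeasure (ν.restrict s) :=
  ⟨le_antisymm ((Measure.restrict_apply_le _ _).trans hν.singleton_zero.le) bot_le,
    (setLIntegral_le_lintegral _ _).trans_lt hν.lintegral_lt_top⟩

theorem integrable_levyIntegrand (hν : IsLevyMeasure ν) (u : ℝ) :
    Integrable (levyIntegrand u) ν :=
  (hν.integrable_min.const_mul (2 + 3 * u ^ 2)).mono'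
    (measurable_levyIntegrand u).aestronglyMeasurable (ae_of_all _ (norm_levyIntegrand_le u))

theorem norm_levyExponent_le (hν : IsLevyMeasure ν) (γ u : ℝ) :
    ‖levyExponent γ 0 ν u‖ ≤ |γ| * |u| + (2 + 3 * u ^ 2) * ∫ x, min 1 (x ^ 2) ∂ν := by
  rw [levyExponent_zero_variance]
  refine (norm_add_le _ _).trans (add_le_add ?_ ?_)
  · simp
  · rw [← integral_const_mul]
    exact norm_integral_le_of_norm_le (hν.integrable_min.const_mul _)
      (ae_of_all _ (norm_levyIntegrand_le u))

theorem continuous_levyExponent (hν : IsLevyMeasure ν) (γ : ℝ) :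
    Continuous (levyExponent γ 0 ν) := by
  have : levyExponent γ 0 ν = fun u => Complex.I * γ * u + ∫ x, levyIntegrand u x ∂ν :=
    funext (levyExponent_zero_variance γ ν)
  rw [this]
  refine Continuous.add (by fun_prop) (continuous_iff_continuousAt.2 fun u₀ => ?_)
  refine continuousAt_of_dominated
    (bound := fun x => (2 + 3 * (|u₀| + 1) ^ 2) * min 1 (x ^ 2))
    (Eventually.of_forall fun u => (measurable_levyIntegrand u).aestronglyMeasurable) ?_
    (hν.integrable_min.const_mul _)
    (ae_of_all _ fun x => (continuous_levyIntegrand_left x).continuousAt)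
  filter_upwards [Metric.ball_mem_nhds u₀ one_pos] with u hu
  refine ae_of_all _ fun x => (norm_levyIntegrand_le u x).trans ?_
  have h1 : |u| ≤ |u₀| + 1 := by
    have := abs_sub_abs_le_abs_sub u u₀
    rw [Metric.mem_ball, Real.dist_eq] at hu
    linarith
  have h2 : u ^ 2 ≤ (|u₀| + 1) ^ 2 := by rw [← sq_abs u]; gcongr
  gcongr

end IsLevyMeasure

theorem levyExponent_apply_zero (γ : ℝ) (ν : Measure ℝ) : levyExponent γ 0 ν 0 = 0 := by
  simp [levyExponent]

/-! ### Truncation of small jumps -/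

/-- The set of jumps of size greater than `1 / (n + 1)`. -/
def largeJumps (n : ℕ) : Set ℝ := {x | 1 / ((n : ℝ) + 1) < |x|}

theorem measurableSet_largeJumps (n : ℕ) : MeasurableSet (largeJumps n) :=
  measurableSet_lt measurable_const (by fun_prop)

theorem monotone_largeJumps : Monotone largeJumps := fun m n hmn x hx => by
  have : 1 / ((n : ℝ) + 1) ≤ 1 / ((m : ℝ) + 1) := by gcongr
  exact this.trans_lt hx

theorem iUnion_largeJumps : ⋃ n, largeJumps n = {0}ᶜ := by
  ext x
  simp only [Set.mem_iUnion, largeJumps, Set.mem_ofPred_eq, Set.mem_compl_iff, Set.mem_singleton_iff]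
  refine ⟨fun ⟨n, hn⟩ h => ?_, fun h => exists_nat_one_div_lt (abs_pos.2 h)⟩
  rw [h, abs_zero] at hn
  exact absurd hn (not_lt.2 (by positivity))

namespace IsLevyMeasure

variable {ν : Measure ℝ}

theorem measure_largeJumps_lt_top (hν : IsLevyMeasure ν) (n : ℕ) : ν (largeJumps n) < ∞ := by
  have hpos : (0 : ℝ) < (1 / ((n : ℝ) + 1)) ^ 2 := by positivity
  refine (measure_mono fun x hx => ?_).trans_lt (hν.integrable_min.measure_norm_ge_lt_top hpos)
  have h1 : (1 / ((n : ℝ) + 1)) ^ 2 ≤ |x| ^ 2 := by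
    have : 1 / ((n : ℝ) + 1) ≤ |x| := le_of_lt hx
    gcongr
  have h2 : (1 / ((n : ℝ) + 1)) ^ 2 ≤ 1 := by
    refine pow_le_one₀ (by positivity) ?_
    rw [div_le_one (by positivity)]
    linarith [Nat.cast_nonneg (α := ℝ) n]
  rw [sq_abs] at h1
  exact (le_min h2 h1).trans (Real.le_norm_self _)

theorem tendsto_measure_largeJumps (hν : IsLevyMeasure ν) :
    Tendsto (fun n => ν (largeJumps n)) atTop (𝓝 (ν Set.univ)) := by
  have h := tendsto_measure_iUnion_atTop (μ := ν) monotone_largeJumps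
  have h0 : ({0}ᶜ : Set ℝ) =ᵐ[ν] Set.univ :=
    eventuallyEq_univ.2 (compl_mem_ae_iff.2 hν.singleton_zero)
  rwa [iUnion_largeJumps, measure_congr h0] at h

theorem tendsto_levyExponent_largeJumps (hν : IsLevyMeasure ν) (γ u : ℝ) :
    Tendsto (fun n => levyExponent γ 0 (ν.restrict (largeJumps n)) u) atTop
      (𝓝 (levyExponent γ 0 ν u)) := by
  simp only [levyExponent_zero_variance]
  refine tendsto_const_nhds.add ?_
  have h := tendsto_setIntegral_of_monotone measurableSet_largeJumps monotone_largeJumps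
    (hν.integrable_levyIntegrand u).integrableOn
  have h0 : ∀ᵐ x ∂ν, x ∈ ({0} : Set ℝ)ᶜ := measure_eq_zero_iff_ae_notMem.1 hν.singleton_zero
  rwa [iUnion_largeJumps, Measure.restrict_eq_self_of_ae_mem h0] at h

/-- Dominated convergence: restricting `ν` decreases the integral of `min 1 (x ^ 2)`, and `|s * u| ≤
|u|`, so one bound serves all `n` and `s`. -/
theorem tendsto_integral_levyExponent_largeJumps (hν : IsLevyMeasure ν) (γ u : ℝ) :
    Tendsto (fun n => ∫ s in (0 : ℝ)..1, levyExponent γ 0 (ν.restrict (largeJumps n)) (s * u))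
      atTop (𝓝 (∫ s in (0 : ℝ)..1, levyExponent γ 0 ν (s * u))) := by
  refine intervalIntegral.tendsto_integral_filter_of_dominated_convergence
    (fun _ => |γ| * |u| + (2 + 3 * u ^ 2) * ∫ x, min 1 (x ^ 2) ∂ν)
    (Eventually.of_forall fun n => ?_) (Eventually.of_forall fun n => ae_of_all _ fun s hs => ?_)
    (by simp) (ae_of_all _ fun s _ => hν.tendsto_levyExponent_largeJumps γ _)
  · have := (hν.restrict (largeJumps n)).continuous_levyExponent γ
    exact (by fun_prop : Continuous fun s : ℝ =>
      levyExponent γ 0 (ν.restrict (largeJumps n)) (s * u)).aestronglyMeasurable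
  · rw [Set.uIoc_of_le zero_le_one] at hs
    refine ((hν.restrict _).norm_levyExponent_le γ _).trans ?_
    have h1 : |s * u| ≤ |u| := by
      rw [abs_mul, abs_of_pos hs.1]; exact mul_le_of_le_one_left (abs_nonneg u) hs.2
    have h2 : (s * u) ^ 2 ≤ u ^ 2 := sq_le_sq.2 h1
    have h3 : ∫ x in largeJumps n, min 1 (x ^ 2) ∂ν ≤ ∫ x, min 1 (x ^ 2) ∂ν :=
      setIntegral_le_integral hν.integrable_min (ae_of_all _ fun x => by positivity)
    have h4 : 0 ≤ ∫ x in largeJumps n, min 1 (x ^ 2) ∂ν :=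
      integral_nonneg fun x => by positivity
    gcongr

end IsLevyMeasure

/-! ### Scaling jumps by a uniform factor -/

/-- The image of `dt ⊗ κ` on `[0, 1] × ℝ` under multiplication. -/
noncomputable def uniformScaling (κ : Measure ℝ) : Measure ℝ :=
  ((volume.restrict (Set.Ioc (0 : ℝ) 1)).prod κ).map fun p => p.1 * p.2

instance isFiniteMeasure_uniformScaling (κ : Measure ℝ) [IsFiniteMeasure κ] :
    IsFiniteMeasure (uniformScaling κ) := by
  unfold uniformScaling; infer_instance

theorem uniformScaling_univ (κ : Measure ℝ) [IsFiniteMeasure κ] :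
    uniformScaling κ Set.univ = κ Set.univ := by
  rw [uniformScaling, Measure.map_apply (by fun_prop) MeasurableSet.univ, Set.preimage_univ,
    ← Set.univ_prod_univ, Measure.prod_prod]
  simp

theorem uniformScaling_add (κ₁ κ₂ : Measure ℝ) [IsFiniteMeasure κ₁] [IsFiniteMeasure κ₂] :
    uniformScaling (κ₁ + κ₂) = uniformScaling κ₁ + uniformScaling κ₂ := by
  rw [uniformScaling, Measure.prod_add, Measure.map_add _ _ (by fun_prop)]
  rfl

/-- By Fubini it suffices to fix `x ≠ 0`, where the dilation `t ↦ t * x` pulls null sets back to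
null sets. A jump measure charging `0` would leave an atom there. -/
theorem uniformScaling_absolutelyContinuous (κ : Measure ℝ) [IsFiniteMeasure κ] (h0 : κ {0} = 0) :
    uniformScaling κ ≪ volume := by
  refine Measure.AbsolutelyContinuous.mk fun s hs h => ?_
  have hm : Measurable fun p : ℝ × ℝ => p.1 * p.2 := by fun_prop
  rw [uniformScaling, Measure.map_apply hm hs, Measure.prod_apply_symm (hm hs)]
  refine (lintegral_congr_ae ?_).trans lintegral_zero
  filter_upwards [measure_eq_zero_iff_ae_notMem.1 h0] with x hx
  refine le_antisymm ((Measure.restrict_apply_le _ _).trans ?_) bot_le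
  have : (fun t : ℝ => (t, x)) ⁻¹' ((fun p : ℝ × ℝ => p.1 * p.2) ⁻¹' s) = (fun t => t * x) ⁻¹' s :=
    rfl
  rw [this, Real.volume_preimage_mul_right hx, h, mul_zero]

theorem charFun_uniformScaling (κ : Measure ℝ) [IsFiniteMeasure κ] (u : ℝ) :
    charFun (uniformScaling κ) u = ∫ s in (0 : ℝ)..1, charFun κ (s * u) := by
  rw [charFun_apply_real, uniformScaling, integral_map (by fun_prop) (by fun_prop),
    integral_prod, intervalIntegral.integral_of_le zero_le_one]
  · refine integral_congr_ae (ae_of_all _ fun s => ?_)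
    simp only [charFun_apply_real]
    refine integral_congr_ae (ae_of_all _ fun x => ?_)
    simp only; push_cast; ring_nf
  · refine Integrable.of_bound (by fun_prop) 1 (ae_of_all _ fun x => ?_)
    rw [← Complex.ofReal_mul, Complex.norm_exp_ofReal_mul_I]

/-- For finite `κ` the compensator is integrable by itself and can be absorbed into the drift. -/
theorem levyExponent_eq_charFun (κ : Measure ℝ) [IsFiniteMeasure κ] (γ u : ℝ) :
    levyExponent γ 0 κ u =
      Complex.I * ((γ - ∫ x in Set.Icc (-1 : ℝ) 1, x ∂κ : ℝ) : ℂ) * u +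
        (charFun κ u - κ.real Set.univ) := by
  have h1 : Integrable (fun x : ℝ => Complex.exp (Complex.I * u * x)) κ := by
    refine Integrable.of_bound (by fun_prop) 1 (ae_of_all _ fun x => ?_)
    rw [mul_assoc, ← Complex.ofReal_mul, Complex.norm_exp_I_mul_ofReal]
  have h2 : Integrable ((Set.Icc (-1 : ℝ) 1).indicator fun y : ℝ => Complex.I * u * y) κ := by
    rw [integrable_indicator_iff measurableSet_Icc]
    exact (by fun_prop : Continuous fun y : ℝ => Complex.I * u * y).continuousOn.integrableOn_Icc
  rw [levyExponent_zero_variance]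
  unfold levyIntegrand
  have h4 := integral_sub (h1.sub (integrable_const 1)) h2
  simp only [Pi.sub_apply] at h4
  rw [h4, integral_sub h1 (integrable_const 1),
    integral_indicator measurableSet_Icc, integral_const_mul, integral_complex_ofReal,
    integral_const, charFun_apply_real, Complex.real_smul, Complex.ofReal_sub]
  have h3 : ∀ x : ℝ, Complex.I * u * x = u * x * Complex.I := fun x => by ring
  simp only [h3]
  ring

/-- A compound Poisson law whose characteristic function is
`exp (∫₀¹ levyExponent γ 0 κ (s u) ds)`, up to a translation. -/
theorem charFun_dirac_conv_compoundPoisson (κ : Measure ℝ) [IsFiniteMeasure κ] (γ u : ℝ) :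
    charFun (Measure.dirac ((γ - ∫ x in Set.Icc (-1 : ℝ) 1, x ∂κ) / 2) ∗
      compoundPoisson (uniformScaling κ)) u =
      Complex.exp (∫ s in (0 : ℝ)..1, levyExponent γ 0 κ (s * u)) := by
  have hreal : (uniformScaling κ).real Set.univ = κ.real Set.univ := by
    rw [measureReal_def, uniformScaling_univ, measureReal_def]
  rw [charFun_conv, charFun_dirac, charFun_compoundPoisson, ← Complex.exp_add,
    charFun_uniformScaling, hreal]
  simp only [levyExponent_eq_charFun]
  have hi : IntervalIntegrable (fun s : ℝ => charFun κ (s * u)) volume 0 1 := by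
    refine IntervalIntegrable.mono_fun' (g := fun _ => κ.real Set.univ) (by simp)
      (Measurable.aestronglyMeasurable (by fun_prop)) (ae_of_all _ fun s => norm_charFun_le _)
  set b : ℝ := γ - ∫ x in Set.Icc (-1 : ℝ) 1, x ∂κ
  rw [intervalIntegral.integral_add
    ((by fun_prop : Continuous fun s : ℝ => Complex.I * (b : ℂ) * ((s * u : ℝ) : ℂ)).intervalIntegrable
      _ _) (hi.sub (by simp)), intervalIntegral.integral_sub hi (by simp)]
  congr 2
  · have h2 : ∫ s in (0 : ℝ)..1, (s : ℂ) = 1 / 2 := by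
      rw [intervalIntegral.integral_ofReal, integral_id]
      norm_num
    simp only [Complex.ofReal_mul, intervalIntegral.integral_const_mul,
      intervalIntegral.integral_mul_const, h2]
    simp
    ring
  · simp

/-! ### The characteristic function of the integral -/

/-- Summation by parts, turning a Riemann sum of the path into a weighted sum of increments. -/
theorem sum_range_eq_sum_mul_sub (z : ℕ → ℝ) (n : ℕ) :
    ∑ j ∈ Finset.range n, z (j + 1) =
      ∑ j ∈ Finset.range n, ((n : ℝ) - j) * (z (j + 1) - z j) + n * z 0 := by
  induction n with
  | zero => simp
  | succ n ih =>
    have h : ∀ j ∈ Finset.range n, (((n + 1 : ℕ) : ℝ) - j) * (z (j + 1) - z j) =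
        ((n : ℝ) - j) * (z (j + 1) - z j) + (z (j + 1) - z j) := fun j _ => by push_cast; ring
    rw [Finset.sum_range_succ, ih, Finset.sum_range_succ, Finset.sum_congr rfl h,
      Finset.sum_add_distrib, Finset.sum_range_sub]
    push_cast
    ring

namespace IsLevyProcess

variable {Ω : Type*} [MeasurableSpace Ω] {P : Measure Ω} {Z : ℝ≥0 → Ω → ℝ}

/-- The characteristic function of a linear combination of the increments of a Lévy process along
the grid of mesh `h`. -/
theorem charFun_linearCombination_increments (hZ : IsLevyProcess Z P) (h : ℝ≥0) (n : ℕ)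
    (c : ℕ → ℝ) (u : ℝ) :
    charFun (P.map fun ω => ∑ j ∈ Finset.range n,
      c j * (Z (((j + 1 : ℕ) : ℝ≥0) * h) ω - Z ((j : ℝ≥0) * h) ω)) u =
      ∏ j ∈ Finset.range n, charFun (P.map fun ω => Z h ω - Z 0 ω) (c j * u) := by
  have hmono : Monotone fun j : ℕ => (j : ℝ≥0) * h := fun i j hij => by
    have : (i : ℝ≥0) ≤ j := by exact_mod_cast hij
    simp only; gcongr
  have hind := (hZ.indep.nat hmono).comp (fun j x => c j * x) fun j => measurable_const_mul (c j)
  have hm : ∀ j : ℕ, Measurable fun ω => Z (((j + 1 : ℕ) : ℝ≥0) * h) ω - Z ((j : ℝ≥0) * h) ω :=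
    fun j => (hZ.measurable _).sub (hZ.measurable _)
  have := congrFun (iIndepFun.charFun_map_fun_finsetSum_eq_prod (s := Finset.range n)
    (fun j _ => ((hm j).const_mul (c j)).aemeasurable) (hind.restrict _)) u
  rw [this, Finset.prod_apply]
  refine Finset.prod_congr rfl fun j _ => ?_
  rw [charFun_map_mul_comp (hm j).aemeasurable]
  have hst := (hZ.stationary ((j : ℝ≥0) * h) h).map_eq
  rw [← hst]
  push_cast
  rw [add_mul, one_mul]

/-- The triplet prescribes only the law of `Z 1`, which is a sum of `n + 1` independent copies of
this increment; continuity selects the right root. -/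
theorem charFun_increment [IsProbabilityMeasure P] (hZ : IsLevyProcess Z P) {γ : ℝ} {ν : Measure ℝ}
    (hT : HasLevyTriplet Z P γ 0 ν) (n : ℕ) (u : ℝ) :
    charFun (P.map fun ω => Z ((n + 1 : ℕ) : ℝ≥0)⁻¹ ω - Z 0 ω) u =
      Complex.exp (levyExponent γ 0 ν u / (n + 1 : ℕ)) := by
  have hprob : IsProbabilityMeasure (P.map fun ω => Z ((n + 1 : ℕ) : ℝ≥0)⁻¹ ω - Z 0 ω) :=
    Measure.isProbabilityMeasure_map ((hZ.measurable _).sub (hZ.measurable _)).aemeasurable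
  refine eq_exp_div_of_pow_eq_exp (by fun_prop) (hT.isLevyMeasure.continuous_levyExponent γ)
    (by rw [charFun_zero, probReal_univ, Complex.ofReal_one]) (levyExponent_apply_zero γ ν)
    n.succ_ne_zero (fun u => ?_) u
  have h := hZ.charFun_linearCombination_increments ((n + 1 : ℕ) : ℝ≥0)⁻¹ (n + 1) (fun _ => 1) u
  simp only [one_mul, Finset.prod_const, Finset.card_range] at h
  rw [← h, ← hT.charFun_eq]
  congr 1
  refine Measure.map_congr ?_
  filter_upwards [hZ.zero] with ω hω
  rw [Finset.sum_range_sub (fun j : ℕ => Z ((j : ℝ≥0) * ((n + 1 : ℕ) : ℝ≥0)⁻¹) ω),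
    mul_inv_cancel₀ (by positivity)]
  simp [hω]

/-- The characteristic function of the right Riemann sums of the paths of a Lévy process. -/
theorem charFun_riemann_sum [IsProbabilityMeasure P] (hZ : IsLevyProcess Z P) {γ : ℝ} {ν : Measure ℝ}
    (hT : HasLevyTriplet Z P γ 0 ν) (n : ℕ) (u : ℝ) :
    charFun (P.map fun ω => ((n + 1 : ℕ) : ℝ)⁻¹ • ∑ j ∈ Finset.range (n + 1),
      Z (((j + 1 : ℕ) : ℝ) / ((n + 1 : ℕ) : ℝ)).toNNReal ω) u =
      Complex.exp (((n + 1 : ℕ) : ℝ)⁻¹ • ∑ j ∈ Finset.range (n + 1),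
        levyExponent γ 0 ν ((((j + 1 : ℕ) : ℝ) / ((n + 1 : ℕ) : ℝ)) * u)) := by
  have hn : ((n + 1 : ℕ) : ℝ) ≠ 0 := by positivity
  have h := hZ.charFun_linearCombination_increments ((n + 1 : ℕ) : ℝ≥0)⁻¹ (n + 1)
    (fun j => (((n + 1 : ℕ) : ℝ) - j) / ((n + 1 : ℕ) : ℝ)) u
  simp only [hZ.charFun_increment hT] at h
  rw [← Complex.exp_sum, ← Finset.sum_div, ← Finset.sum_range_reflect] at h
  have hs : ∑ j ∈ Finset.range (n + 1), levyExponent γ 0 ν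
      ((((n + 1 : ℕ) : ℝ) - ((n + 1 - 1 - j : ℕ) : ℝ)) / ((n + 1 : ℕ) : ℝ) * u) =
      ∑ j ∈ Finset.range (n + 1),
        levyExponent γ 0 ν ((((j + 1 : ℕ) : ℝ) / ((n + 1 : ℕ) : ℝ)) * u) := by
    refine Finset.sum_congr rfl fun j hj => ?_
    have hj' : j ≤ n := Nat.lt_succ_iff.1 (Finset.mem_range.1 hj)
    rw [Nat.add_sub_cancel, Nat.cast_sub hj']
    push_cast
    ring_nf
  rw [hs] at h
  rw [Complex.real_smul, Complex.ofReal_inv, Complex.ofReal_natCast, inv_mul_eq_div, ← h]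
  congr 1
  refine Measure.map_congr ?_
  filter_upwards [hZ.zero] with ω hω
  have hcast : ∀ j : ℕ, ((j : ℝ) / ((n + 1 : ℕ) : ℝ)).toNNReal =
      (j : ℝ≥0) * ((n + 1 : ℕ) : ℝ≥0)⁻¹ := fun j => by
    rw [Real.toNNReal_div (Nat.cast_nonneg _), Real.toNNReal_natCast, Real.toNNReal_natCast,
      div_eq_mul_inv]
  simp only [hcast]
  rw [sum_range_eq_sum_mul_sub (fun j : ℕ => Z ((j : ℝ≥0) * ((n + 1 : ℕ) : ℝ≥0)⁻¹) ω)]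
  simp only [Nat.cast_zero, zero_mul, hω, mul_zero, add_zero, smul_eq_mul, Finset.mul_sum]
  refine Finset.sum_congr rfl fun j _ => ?_
  rw [div_mul_eq_mul_div, inv_mul_eq_div]

theorem ae_intervalIntegrable_and_tendsto (hZ : IsLevyProcess Z P) : ∀ᵐ ω ∂P,
    IntervalIntegrable (fun t : ℝ => Z t.toNNReal ω) volume 0 1 ∧
      Tendsto (fun n : ℕ => ((n + 1 : ℕ) : ℝ)⁻¹ • ∑ j ∈ Finset.range (n + 1),
        Z (((j + 1 : ℕ) : ℝ) / ((n + 1 : ℕ) : ℝ)).toNNReal ω) atTop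
        (𝓝 (∫ t in (0 : ℝ)..1, Z t.toNNReal ω)) := by
  filter_upwards [hZ.cadlag] with ω hω
  obtain ⟨C, hC⟩ := hω.exists_norm_le 1
  refine tendsto_right_riemann_sum (f := fun t : ℝ => Z t.toNNReal ω) (C := C)
    (fun t ht => hC _ (Real.toNNReal_le_one.2 ht.2)) fun t _ => ?_
  exact (hω.1 t.toNNReal).comp continuous_real_toNNReal.continuousWithinAt
    fun s hs => Real.toNNReal_le_toNNReal hs

theorem measurable_riemann_sum (hZ : IsLevyProcess Z P) (n : ℕ) :
    Measurable fun ω => ((n + 1 : ℕ) : ℝ)⁻¹ • ∑ j ∈ Finset.range (n + 1),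
      Z (((j + 1 : ℕ) : ℝ) / ((n + 1 : ℕ) : ℝ)).toNNReal ω :=
  (Finset.measurable_fun_sum _ fun _ _ => hZ.measurable _).const_mul _

theorem aemeasurable_integral (hZ : IsLevyProcess Z P) :
    AEMeasurable (fun ω => ∫ t in (0 : ℝ)..1, Z t.toNNReal ω) P :=
  aemeasurable_of_tendsto_metrizable_ae atTop (fun n => (hZ.measurable_riemann_sum n).aemeasurable)
    (hZ.ae_intervalIntegrable_and_tendsto.mono fun _ h => h.2)

/-- The characteristic function of the integral of a Lévy process. -/
theorem charFun_integral [IsProbabilityMeasure P] (hZ : IsLevyProcess Z P) {γ : ℝ} {ν : Measure ℝ}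
    (hT : HasLevyTriplet Z P γ 0 ν) (u : ℝ) :
    charFun (P.map fun ω => ∫ t in (0 : ℝ)..1, Z t.toNNReal ω) u =
      Complex.exp (∫ s in (0 : ℝ)..1, levyExponent γ 0 ν (s * u)) := by
  have hcont : Continuous fun s : ℝ => levyExponent γ 0 ν (s * u) :=
    (hT.isLevyMeasure.continuous_levyExponent γ).comp (continuous_mul_const u)
  obtain ⟨C, hC⟩ := isCompact_Icc.exists_bound_of_continuousOn
    (s := Set.Icc (0 : ℝ) 1) hcont.continuousOn
  have h1 := (tendsto_right_riemann_sum hC fun t _ => hcont.continuousWithinAt).2.cexp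
  simp only [← hZ.charFun_riemann_sum hT] at h1
  -- The characteristic functions of the Riemann sums also converge to that of the integral, by
  -- almost sure convergence and the bound `1`.
  refine tendsto_nhds_unique ?_ h1
  simp only [charFun_apply_real]
  rw [integral_map hZ.aemeasurable_integral (by fun_prop)]
  have h2 : ∀ n : ℕ, _ := fun n => integral_map (μ := P)
    (hZ.measurable_riemann_sum n).aemeasurable
    (f := fun x : ℝ => Complex.exp (u * x * Complex.I)) (by fun_prop)
  simp only [h2]
  refine tendsto_integral_of_dominated_convergence (fun _ => 1) (fun n => ?_) (integrable_const 1)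
    (fun n => ae_of_all _ fun ω => ?_) ?_
  · have := hZ.measurable_riemann_sum n
    exact Measurable.aestronglyMeasurable (by fun_prop)
  · rw [← Complex.ofReal_mul, Complex.norm_exp_ofReal_mul_I]
  · filter_upwards [hZ.ae_intervalIntegrable_and_tendsto] with ω hω
    exact ((by fun_prop : Continuous fun x : ℝ => Complex.exp (u * x * Complex.I)).tendsto _).comp
      hω.2

end IsLevyProcess

/-! ### The atom for finite `ν`, absolute continuity for infinite `ν` -/

/-- If the Lévy measure is finite, the law is a translated compound Poisson law and has an atom. -/
theorem not_absolutelyContinuous_of_finite {ν : Measure ℝ} [IsFiniteMeasure ν] {γ : ℝ}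
    {μ : Measure ℝ} [IsFiniteMeasure μ] (hμ : ∀ u, charFun μ u =
      Complex.exp (∫ s in (0 : ℝ)..1, levyExponent γ 0 ν (s * u))) : ¬ μ ≪ volume := by
  intro hac
  set a : ℝ := (γ - ∫ x in Set.Icc (-1 : ℝ) 1, x ∂ν) / 2 with ha
  have h : μ = Measure.dirac a ∗ compoundPoisson (uniformScaling ν) :=
    Measure.ext_of_charFun (funext fun u => by
      rw [hμ, ha, charFun_dirac_conv_compoundPoisson])
  obtain ⟨A, hA, -⟩ := exists_compoundPoisson_eq_add (uniformScaling ν)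
  have h0 : μ {a} = 0 := hac (measure_singleton a)
  rw [h, Measure.dirac_conv, Measure.map_apply (by fun_prop) (measurableSet_singleton a), hA,
    Measure.add_apply, add_eq_zero, Measure.smul_apply, smul_eq_mul,
    Measure.dirac_apply_of_mem (by simp), mul_one, ENNReal.ofReal_eq_zero] at h0
  exact absurd h0.1 (not_le.2 (Real.exp_pos _))

/-- If the Lévy measure is infinite, the law is the weak limit of laws which factor through compound
Poisson laws with arbitrarily small atom at `0`. -/
theorem absolutelyContinuous_of_infinite {ν : Measure ℝ} (hν : IsLevyMeasure ν)
    (hinf : ν Set.univ = ∞) {γ : ℝ} {μ : Measure ℝ} [IsProbabilityMeasure μ]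
    (hμ : ∀ u, charFun μ u =
      Complex.exp (∫ s in (0 : ℝ)..1, levyExponent γ 0 ν (s * u))) : μ ≪ volume := by
  have hfin : ∀ n, IsFiniteMeasure (ν.restrict (largeJumps n)) := fun n =>
    ⟨by simpa using hν.measure_largeJumps_lt_top n⟩
  -- These centerings need not converge; each is absorbed into the cofactor `R`, on which the bound
  -- does not depend. The `2` comes from `∫₀¹ s ds = 1 / 2`.
  let a : ℕ → ℝ := fun m =>
    (γ - ∫ x in Set.Icc (-1 : ℝ) 1, x ∂(ν.restrict (largeJumps m))) / 2
  let μs : ℕ → ProbabilityMeasure ℝ := fun m =>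
    ⟨Measure.dirac (a m) ∗ compoundPoisson (uniformScaling (ν.restrict (largeJumps m))),
      inferInstance⟩
  have hlim : Tendsto μs atTop (𝓝 ⟨μ, inferInstance⟩) := by
    refine ProbabilityMeasure.tendsto_of_tendsto_charFun fun u => ?_
    simp only [μs, a, ProbabilityMeasure.coe_mk, hμ, charFun_dirac_conv_compoundPoisson]
    exact (hν.tendsto_integral_levyExponent_largeJumps γ u).cexp
  refine Measure.AbsolutelyContinuous.mk fun N _ hN => ?_
  have hle : ∀ n, μ N ≤ ENNReal.ofReal (Real.exp (-(ν.restrict (largeJumps n)).real Set.univ)) := by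
    intro n
    have h := measure_null_le_of_tendsto (uniformScaling_absolutelyContinuous
      (ν.restrict (largeJumps n)) (hν.restrict _).singleton_zero) hlim ?_ hN
    · rwa [measureReal_def, uniformScaling_univ] at h
    filter_upwards [eventually_ge_atTop n] with m hm
    have hfin' : IsFiniteMeasure (ν.restrict (largeJumps m \ largeJumps n)) :=
      ⟨by simpa using (measure_mono Set.sdiff_subset).trans_lt (hν.measure_largeJumps_lt_top m)⟩
    have hsplit : ν.restrict (largeJumps m) =
        ν.restrict (largeJumps n) + ν.restrict (largeJumps m \ largeJumps n) := by
      rw [← Measure.restrict_union Set.disjoint_sdiff_right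
        ((measurableSet_largeJumps m).diff (measurableSet_largeJumps n)),
        Set.union_sdiff_cancel (monotone_largeJumps hm)]
    -- The cofactor carries the centering and the jumps kept at level `m` but not at level `n`.
    refine ⟨Measure.dirac (a m) ∗ compoundPoisson (uniformScaling
      (ν.restrict (largeJumps m \ largeJumps n))), inferInstance, ?_⟩
    simp only [μs, ProbabilityMeasure.coe_mk]
    rw [hsplit, uniformScaling_add, compoundPoisson_add, ← Measure.conv_assoc,
      ← Measure.conv_assoc, Measure.conv_comm (Measure.dirac (a m))]
  have hreal : Tendsto (fun n => (ν.restrict (largeJumps n)).real Set.univ) atTop atTop := by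
    have h := hν.tendsto_measure_largeJumps
    rw [hinf] at h
    simp only [measureReal_restrict_apply_univ]
    refine tendsto_atTop.2 fun b => ?_
    filter_upwards [h.eventually (lt_mem_nhds (ENNReal.ofReal_lt_top (r := b)))] with n hn
    exact (ENNReal.ofReal_le_iff_le_toReal (hν.measure_largeJumps_lt_top n).ne).1 hn.le
  have hzero : Tendsto (fun n => ENNReal.ofReal
      (Real.exp (-(ν.restrict (largeJumps n)).real Set.univ))) atTop (𝓝 0) := by
    rw [← ENNReal.ofReal_zero]
    exact ENNReal.tendsto_ofReal (Real.tendsto_exp_neg_atTop_nhds_zero.comp hreal)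
  exact le_antisymm (ge_of_tendsto' hzero hle) bot_le

theorem mainTheorem3 {Ω : Type*} [MeasurableSpace Ω] (P : Measure Ω) [IsProbabilityMeasure P]
    (Z : ℝ≥0 → Ω → ℝ) (hZ : IsLevyProcess Z P)
    (γ : ℝ) (ν : Measure ℝ) (hT : HasLevyTriplet Z P γ 0 ν) :
    (∀ᵐ ω ∂P, IntervalIntegrable (fun t : ℝ => Z t.toNNReal ω) volume 0 1) ∧
    AEMeasurable (fun ω => ∫ t in (0 : ℝ)..1, Z t.toNNReal ω) P ∧
    (P.map (fun ω => ∫ t in (0 : ℝ)..1, Z t.toNNReal ω) ≪ (volume : Measure ℝ) ↔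
      ν Set.univ = ∞) := by
  refine ⟨hZ.ae_intervalIntegrable_and_tendsto.mono fun _ h => h.1, hZ.aemeasurable_integral, ?_⟩
  have hprob := Measure.isProbabilityMeasure_map hZ.aemeasurable_integral
  refine ⟨fun hac => ?_, fun hinf =>
    absolutelyContinuous_of_infinite hT.isLevyMeasure hinf (hZ.charFun_integral hT)⟩
  by_contra hfin
  have : IsFiniteMeasure ν := ⟨lt_top_iff_ne_top.2 hfin⟩
  exact not_absolutelyContinuous_of_finite (hZ.charFun_integral hT) hac
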